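/- **Definitions.** Let the modular group act on $\mathbb{Q}\cup\{\infty\}$ through its generators $T(x)=x+1$, $S(x)=-\frac1x$, and on $\mathbb{Q}(q)\cup\{\infty\}$ through $T_q(X)=qX+1$, $S_q(X)=-\frac{1}{qX}$. There is a unique map $[\,\cdot\,]_q:\mathbb{Q}\cup\{\infty\}\to\mathbb{Q}(q)\cup\{\infty\}$ with $[0]_q=0$ that commutes with these actions. Explicitly, with $[c]_q=\frac{1-q^c}{1-q}$ for $c\in\mathbb{Z}$, a rational that is not an integer, written as $x=c-\frac1y$ with $c=\lceil x\rceil$ and $y>1$, has $[x]_q=[c]_q-\frac{q^{c-1}}{[y]_q}$. For rational $x$, the series $[x]_q$ is the Laurent expansion of this rational function at $q=0$. For irrational $x$, the series $[x]_q$ is the formal Laurent series to which the expansions of $[x_n]_q$ at $q=0$ stabilize, coefficient by coefficient, for every sequence of rationals $x_n\to x$. **Theorem.** For every real $x>0$, the series $[x]_q$ is well defined and is a power series in $q$ with integer coefficients, and, as a power series in a complex variable $q$, it has radius of convergence $$R(x)>3-2\sqrt2,$$ where $R(x)\in(0,\infty]$. -/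

import Mathlib

open Filter Topology
open scoped LaurentSeries PowerSeries

namespace QReal

/-- The matrix `T_q` with rows `(q, 1)` and `(0, 1)`; for `q = 1` it is the matrix `T`.
Mathlib's action of `GL₂(K)` on `OnePoint K` makes it act by `z ↦ q z + 1`. -/
noncomputable def matT {K : Type*} [Field K] (q : K) (hq : q ≠ 0) : GL (Fin 2) K :=
  Matrix.GeneralLinearGroup.mkOfDetNeZero !![q, 1; 0, 1] (by simpa [Matrix.det_fin_two] using hq)

/-- The matrix `S_q` with rows `(0, -1)` and `(q, 0)`; for `q = 1` it is the matrix `S`.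
It acts on `OnePoint K` by `z ↦ -1 / (q z)`. -/
noncomputable def matS {K : Type*} [Field K] (q : K) (hq : q ≠ 0) : GL (Fin 2) K :=
  Matrix.GeneralLinearGroup.mkOfDetNeZero !![0, -1; q, 0] (by simpa [Matrix.det_fin_two] using hq)

open Classical in
/-- A map `ℚ ∪ {∞} → ℚ(q) ∪ {∞}` is a quantization if it sends `0` to `0` and commutes with the
actions of the modular group: `T`, `S` act on the source, and `T_q`, `S_q` on the target. -/
def IsQuantization (φ : OnePoint ℚ → OnePoint (RatFunc ℚ)) : Prop :=
  φ ((0 : ℚ) : OnePoint ℚ) = ((0 : RatFunc ℚ) : OnePoint (RatFunc ℚ)) ∧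
  (∀ x, φ (matT (1 : ℚ) one_ne_zero • x) = matT (RatFunc.X : RatFunc ℚ) RatFunc.X_ne_zero • φ x) ∧
  (∀ x, φ (matS (1 : ℚ) one_ne_zero • x) = matS (RatFunc.X : RatFunc ℚ) RatFunc.X_ne_zero • φ x)

/-- The `q`-integer `[c]_q = (1 - q ^ c) / (1 - q)`, for `c ∈ ℤ`. -/
noncomputable def qInt (c : ℤ) : RatFunc ℚ := (1 - RatFunc.X ^ c) / (1 - RatFunc.X)

theorem ceil_sub_pos (x : ℚ) (hx : x.den ≠ 1) : 0 < (⌈x⌉ : ℚ) - x := by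
  have hne : x ≠ (⌈x⌉ : ℚ) := by
    intro h
    apply hx
    rw [h]
    simp
  have := lt_of_le_of_ne (Int.le_ceil x) hne
  linarith

theorem den_step_lt (x : ℚ) (hx : x.den ≠ 1) : (1 / ((⌈x⌉ : ℚ) - x)).den < x.den := by
  have hlt : ((⌈x⌉ : ℚ) - x) < 1 := by have := Int.ceil_lt_add_one x; linarith
  have hpos := ceil_sub_pos x hx
  set y : ℚ := (⌈x⌉ : ℚ) - x with hy
  have hyden : y.den = x.den := by
    rw [hy, sub_eq_neg_add, Rat.add_intCast_den, Rat.neg_den]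
  have hnum : 0 < y.num := Rat.num_pos.2 hpos
  rw [one_div, Rat.den_inv_of_ne_zero hpos.ne', ← hyden]
  have := Rat.num_lt_denom_iff.2 hlt
  omega

/-- The `q`-rational `[x]_q ∈ ℚ(q)`, `x ∈ ℚ`, by the negative continued fraction of `x`:
if `x = c - 1 / y` with `c = ⌈x⌉` and `y > 1`, then `[x]_q = [c]_q - q ^ (c - 1) / [y]_q`.
By `isQuantization_iff` this is the only modular-group equivariant map with `[0]_q = 0`. -/
noncomputable def qRat (x : ℚ) : RatFunc ℚ :=
  if x.den = 1 then qInt ⌈x⌉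
  else qInt ⌈x⌉ - RatFunc.X ^ (⌈x⌉ - 1) / qRat (1 / ((⌈x⌉ : ℚ) - x))
termination_by x.den
decreasing_by exact den_step_lt x ‹_›

theorem one_sub_X_ne_zero : (1 - RatFunc.X : RatFunc ℚ) ≠ 0 := by
  have h : (1 - Polynomial.X : Polynomial ℚ) ≠ 0 := by
    intro h
    have := congrArg (Polynomial.eval 0) h
    simp at this
  have := RatFunc.algebraMap_ne_zero (K := ℚ) h
  simpa using this

theorem qInt_add_one (c : ℤ) : qInt (c + 1) = RatFunc.X * qInt c + 1 := by
  have h1 := one_sub_X_ne_zero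
  have hX := RatFunc.X_ne_zero (K := ℚ)
  unfold qInt
  rw [zpow_add_one₀ hX]
  field_simp
  ring

theorem qInt_zero : qInt 0 = 0 := by simp [qInt]

theorem qInt_one : qInt 1 = 1 := by
  simp [qInt, div_self one_sub_X_ne_zero]

theorem qRat_intCast (c : ℤ) : qRat (c : ℚ) = qInt c := by
  rw [qRat]; simp

theorem qRat_of_den_ne_one (x : ℚ) (hx : x.den ≠ 1) :
    qRat x = qInt ⌈x⌉ - RatFunc.X ^ (⌈x⌉ - 1) / qRat (1 / ((⌈x⌉ : ℚ) - x)) := by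
  rw [qRat]; simp [hx]

theorem qRat_add_one (x : ℚ) : qRat (x + 1) = RatFunc.X * qRat x + 1 := by
  have hX := RatFunc.X_ne_zero (K := ℚ)
  have hden : (x + 1).den = x.den := by
    have := Rat.add_intCast_den x 1
    rwa [Int.cast_one] at this
  by_cases hx : x.den = 1
  · have hx' : (x + 1).den = 1 := by rwa [hden]
    rw [qRat, if_pos hx', Int.ceil_add_one, qInt_add_one, qRat, if_pos hx]
  · have hx' : (x + 1).den ≠ 1 := by rwa [hden]
    rw [qRat_of_den_ne_one _ hx', qRat_of_den_ne_one _ hx, Int.ceil_add_one, qInt_add_one]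
    have e : (1 / (((⌈x⌉ + 1 : ℤ) : ℚ) - (x + 1))) = 1 / ((⌈x⌉ : ℚ) - x) := by
      push_cast; ring
    rw [e, show ⌈x⌉ + 1 - 1 = (⌈x⌉ - 1) + 1 by ring, zpow_add_one₀ hX]
    ring

theorem qInt_eq_poly (n : ℕ) : qInt (n + 1 : ℤ) =
    algebraMap (Polynomial ℚ) (RatFunc ℚ) (1 + Polynomial.X * ∑ i ∈ Finset.range n, Polynomial.X ^ i) := by
  induction n with
  | zero => simp [qInt_one]
  | succ n ih =>
    push_cast
    rw [qInt_add_one, ih, Finset.sum_range_succ', Finset.sum_congr rfl (fun i _ => pow_succ' _ i),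
      ← Finset.mul_sum]
    simp
    ring

/-- For `x ≥ 1` the rational function `[x]_q` takes the value `1` at `q = 0`. -/
theorem qRat_of_one_le : ∀ (x : ℚ), 1 ≤ x → ∃ P Q : Polynomial ℚ, P.coeff 0 = 1 ∧ Q.coeff 0 = 1 ∧
    qRat x = algebraMap _ (RatFunc ℚ) P / algebraMap _ (RatFunc ℚ) Q := by
  suffices H : ∀ (d : ℕ) (x : ℚ), x.den = d → 1 ≤ x → ∃ P Q : Polynomial ℚ,
      P.coeff 0 = 1 ∧ Q.coeff 0 = 1 ∧
      qRat x = algebraMap _ (RatFunc ℚ) P / algebraMap _ (RatFunc ℚ) Q from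
    fun x hx => H _ x rfl hx
  intro d
  induction d using Nat.strong_induction_on with
  | _ d ih =>
  intro x hd hx
  by_cases h1 : x.den = 1
  · obtain ⟨n, hn⟩ : ∃ n : ℕ, ⌈x⌉ = (n : ℤ) + 1 := by
      have : 1 ≤ ⌈x⌉ := by exact_mod_cast hx.trans (Int.le_ceil x)
      exact ⟨(⌈x⌉ - 1).toNat, by omega⟩
    refine ⟨1 + Polynomial.X * ∑ i ∈ Finset.range n, Polynomial.X ^ i, 1, ?_, by simp, ?_⟩
    · simp
    · rw [qRat, if_pos h1, hn, qInt_eq_poly]; simp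
  · have hx1 : 1 < x := lt_of_le_of_ne hx (fun h => h1 (by rw [← h]; simp))
    obtain ⟨n, hn⟩ : ∃ n : ℕ, ⌈x⌉ = (n : ℤ) + 1 + 1 := by
      have : 1 < ⌈x⌉ := by exact_mod_cast hx1.trans_le (Int.le_ceil x)
      exact ⟨(⌈x⌉ - 2).toNat, by omega⟩
    have hpos := ceil_sub_pos x h1
    have hlt : ((⌈x⌉ : ℚ) - x) < 1 := by have := Int.ceil_lt_add_one x; linarith
    have hy : 1 ≤ 1 / ((⌈x⌉ : ℚ) - x) := by
      rw [le_div_iff₀ hpos]; linarith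
    obtain ⟨P, Q, hP, hQ, hPQ⟩ := ih _ (hd ▸ den_step_lt x h1) _ rfl hy
    have hPne : algebraMap _ (RatFunc ℚ) P ≠ 0 :=
      RatFunc.algebraMap_ne_zero (by rintro rfl; simp at hP)
    have hQne : algebraMap _ (RatFunc ℚ) Q ≠ 0 :=
      RatFunc.algebraMap_ne_zero (by rintro rfl; simp at hQ)
    refine ⟨(1 + Polynomial.X * ∑ i ∈ Finset.range (n + 1), Polynomial.X ^ i) * P
      - Polynomial.X ^ (n + 1) * Q, P, ?_, hP, ?_⟩
    · simp [Polynomial.mul_coeff_zero, hP]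
    · rw [qRat_of_den_ne_one x h1, hPQ, hn]
      have := qInt_eq_poly (n + 1)
      rw [Nat.cast_add, Nat.cast_one] at this
      rw [this, show (n : ℤ) + 1 + 1 - 1 = ((n + 1 : ℕ) : ℤ) by push_cast; ring, zpow_natCast]
      simp only [map_sub, map_mul, map_pow, RatFunc.algebraMap_X]
      field_simp

theorem qRat_neg_inv_of_one_le (x : ℚ) (hx : 1 ≤ x) :
    qRat x ≠ 0 ∧ qRat (-1 / x) = -1 / (RatFunc.X * qRat x) := by
  have hX := RatFunc.X_ne_zero (K := ℚ)
  have hne : qRat x ≠ 0 := by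
    obtain ⟨P, Q, hP, hQ, hPQ⟩ := qRat_of_one_le x hx
    rw [hPQ]
    exact div_ne_zero (RatFunc.algebraMap_ne_zero (by rintro rfl; simp at hP))
      (RatFunc.algebraMap_ne_zero (by rintro rfl; simp at hQ))
  refine ⟨hne, ?_⟩
  rcases eq_or_lt_of_le hx with h | h
  · subst h
    have h1 : qRat 1 = 1 := by simpa [qInt_one] using qRat_intCast 1
    have h2 := qRat_add_one (-1)
    have h0 : qRat 0 = 0 := by simpa [qInt_zero] using qRat_intCast 0
    rw [show (-1 + 1 : ℚ) = 0 by ring, h0] at h2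
    rw [h1, show (-1 / 1 : ℚ) = -1 by ring]
    field_simp
    linear_combination -h2
  · have hx0 : 0 < x := by linarith
    have hinv : 1 / x < 1 := by rw [div_lt_one hx0]; exact h
    have hinv0 : 0 < 1 / x := by positivity
    have hc : ⌈-1 / x⌉ = 0 := by
      rw [Int.ceil_eq_iff, neg_div]
      constructor <;> push_cast <;> linarith
    have hden : (-1 / x).den ≠ 1 := by
      intro hd
      have h3 := (Rat.den_eq_one_iff _).1 hd
      have h4 : (-1 : ℚ) < ((-1 / x).num : ℚ) := by rw [h3, neg_div]; linarith
      have h5 : ((-1 / x).num : ℚ) < 0 := by rw [h3, neg_div]; linarith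
      have h4' : (-1 : ℤ) < (-1 / x).num := by exact_mod_cast h4
      have h5' : (-1 / x).num < 0 := by exact_mod_cast h5
      omega
    rw [qRat_of_den_ne_one _ hden, hc, qInt_zero]
    have e : 1 / (((0 : ℤ) : ℚ) - -1 / x) = x := by push_cast; field_simp; ring
    rw [e]
    simp only [zero_sub, zpow_neg, zpow_one]
    field_simp

theorem qRat_neg_inv_of_pos : ∀ (x : ℚ), 0 < x →
    qRat x ≠ 0 ∧ qRat (-1 / x) = -1 / (RatFunc.X * qRat x) := by
  suffices H : ∀ (d : ℕ) (x : ℚ), x.den = d → 0 < x →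
      qRat x ≠ 0 ∧ qRat (-1 / x) = -1 / (RatFunc.X * qRat x) from fun x hx => H _ x rfl hx
  intro d
  have hX := RatFunc.X_ne_zero (K := ℚ)
  induction d using Nat.strong_induction_on with
  | _ d ih =>
  intro x hd hx
  rcases le_or_gt 1 x with h | h
  · exact qRat_neg_inv_of_one_le x h
  have hc : ⌈x⌉ = 1 := by
    rw [Int.ceil_eq_iff]; constructor <;> push_cast <;> linarith
  have hden : x.den ≠ 1 := by
    intro hd
    have h3 := (Rat.den_eq_one_iff _).1 hd
    have h4 : (0 : ℚ) < (x.num : ℚ) := by rw [h3]; linarith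
    have h5 : (x.num : ℚ) < 1 := by rw [h3]; linarith
    have h4' : 0 < x.num := by exact_mod_cast h4
    have h5' : x.num < 1 := by exact_mod_cast h5
    omega
  have h1x : 0 < 1 - x := by linarith
  have hlt := den_step_lt x hden
  have hq := qRat_of_den_ne_one x hden
  rw [hc] at hlt hq
  push_cast at hlt hq
  set w : ℚ := 1 / (1 - x) - 1 with hw
  have hyw : 1 / (1 - x) = w + 1 := by rw [hw]; ring
  have hw0 : 0 < w := by
    have : 1 < 1 / (1 - x) := by rw [lt_div_iff₀ h1x]; linarith
    linarith
  have hwd : w.den < d := by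
    rw [← hd]
    have : w.den = (1 / (1 - x)).den := by
      have := Rat.sub_intCast_den (1 / (1 - x)) 1
      rwa [Int.cast_one] at this
    rwa [this]
  obtain ⟨hW, hS⟩ := ih _ hwd w rfl hw0
  have hzw : -1 / x + 1 = -1 / w := by
    have : w = x / (1 - x) := by rw [hw]; field_simp; ring
    rw [this]; field_simp; ring
  have hz := qRat_add_one (-1 / x)
  rw [hzw, hS] at hz
  rw [hyw, qRat_add_one, qInt_one, zpow_zero] at hq
  set W := qRat w
  have hY : RatFunc.X * W + 1 ≠ 0 := by
    rw [← qRat_add_one]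
    exact (qRat_neg_inv_of_one_le (w + 1) (by linarith)).1
  have hxq : qRat x = RatFunc.X * W / (RatFunc.X * W + 1) := by
    rw [hq]; field_simp; ring
  refine ⟨?_, ?_⟩
  · rw [hxq]; exact div_ne_zero (mul_ne_zero hX hW) hY
  · rw [hxq]
    have : qRat (-1 / x) = (-1 / (RatFunc.X * W) - 1) / RatFunc.X := by
      rw [hz]; field_simp; ring
    rw [this]
    field_simp
    ring

theorem qRat_neg_inv (x : ℚ) (hx : x ≠ 0) :
    qRat x ≠ 0 ∧ qRat (-1 / x) = -1 / (RatFunc.X * qRat x) := by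
  have hX := RatFunc.X_ne_zero (K := ℚ)
  rcases lt_or_gt_of_ne hx with h | h
  · obtain ⟨h1, h2⟩ := qRat_neg_inv_of_pos (-1 / x) (div_pos_of_neg_of_neg (by norm_num) h)
    have e : -1 / (-1 / x) = x := by field_simp
    rw [e] at h2
    rw [h2]
    constructor
    · exact div_ne_zero (by norm_num) (mul_ne_zero hX h1)
    · field_simp
  · exact qRat_neg_inv_of_pos x h

/-- The map `ℚ ∪ {∞} → ℚ(q) ∪ {∞}` given by `x ↦ [x]_q` and `∞ ↦ ∞`. -/
noncomputable def qRatMap : OnePoint ℚ → OnePoint (RatFunc ℚ) := OnePoint.map qRat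

theorem matT_smul_coe {K : Type*} [Field K] [DecidableEq K] (q : K) (hq : q ≠ 0) (z : K) :
    matT q hq • (z : OnePoint K) = ((q * z + 1 : K) : OnePoint K) := by
  simp [OnePoint.smul_some_eq_ite, matT, Matrix.GeneralLinearGroup.mkOfDetNeZero]

theorem matT_smul_infty {K : Type*} [Field K] [DecidableEq K] (q : K) (hq : q ≠ 0) :
    matT q hq • (OnePoint.infty : OnePoint K) = OnePoint.infty := by
  simp [OnePoint.smul_infty_eq_ite, matT, Matrix.GeneralLinearGroup.mkOfDetNeZero]

theorem matS_smul_coe {K : Type*} [Field K] [DecidableEq K] (q : K) (hq : q ≠ 0) (z : K) (hz : z ≠ 0) :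
    matS q hq • (z : OnePoint K) = ((-1 / (q * z) : K) : OnePoint K) := by
  simp [OnePoint.smul_some_eq_ite, matS, Matrix.GeneralLinearGroup.mkOfDetNeZero, hq, hz]

theorem matS_smul_zero {K : Type*} [Field K] [DecidableEq K] (q : K) (hq : q ≠ 0) :
    matS q hq • ((0 : K) : OnePoint K) = OnePoint.infty := by
  simp [OnePoint.smul_some_eq_ite, matS, Matrix.GeneralLinearGroup.mkOfDetNeZero]

theorem matS_smul_infty {K : Type*} [Field K] [DecidableEq K] (q : K) (hq : q ≠ 0) :
    matS q hq • (OnePoint.infty : OnePoint K) = ((0 : K) : OnePoint K) := by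
  simp [OnePoint.smul_infty_eq_ite, matS, Matrix.GeneralLinearGroup.mkOfDetNeZero, hq]

open Classical in
theorem isQuantization_qRatMap : IsQuantization qRatMap := by
  have hX := RatFunc.X_ne_zero (K := ℚ)
  have h0 : qRat 0 = 0 := by simpa [qInt_zero] using qRat_intCast 0
  refine ⟨?_, ?_, ?_⟩
  · simp [qRatMap, h0]
  · intro x
    cases x with
    | infty => simp [qRatMap, matT_smul_infty]
    | coe x => simp [qRatMap, matT_smul_coe, qRat_add_one]
  · intro x
    cases x with
    | infty => simp [qRatMap, matS_smul_infty, h0]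
    | coe x =>
      by_cases hx : x = 0
      · subst hx
        simp only [qRatMap, OnePoint.map_some, h0, matS_smul_zero, OnePoint.map_infty]
      · obtain ⟨h1, h2⟩ := qRat_neg_inv x hx
        simp only [qRatMap, OnePoint.map_some, matS_smul_coe _ _ _ hx, matS_smul_coe _ _ _ h1,
          one_mul, h2]

open Classical in
/-- `x ↦ [x]_q` is the unique map `ℚ ∪ {∞} → ℚ(q) ∪ {∞}` that commutes with the actions of the
modular group and sends `0` to `0`. -/
theorem isQuantization_iff (φ : OnePoint ℚ → OnePoint (RatFunc ℚ)) :
    IsQuantization φ ↔ φ = qRatMap := by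
  refine ⟨fun hφ => ?_, fun h => h ▸ isQuantization_qRatMap⟩
  obtain ⟨g0, gT, gS⟩ := isQuantization_qRatMap
  obtain ⟨f0, fT, fS⟩ := hφ
  have hT : ∀ x, φ (matT (1 : ℚ) one_ne_zero • x) = qRatMap (matT (1 : ℚ) one_ne_zero • x) ↔
      φ x = qRatMap x := by
    intro x; rw [fT, gT, smul_left_cancel_iff]
  have hS : ∀ x, φ x = qRatMap x →
      φ (matS (1 : ℚ) one_ne_zero • x) = qRatMap (matS (1 : ℚ) one_ne_zero • x) := by
    intro x h; rw [fS, gS, h]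
  have hT1 : ∀ x : ℚ, φ ((x + 1 : ℚ) : OnePoint ℚ) = qRatMap ((x + 1 : ℚ) : OnePoint ℚ) ↔
      φ (x : OnePoint ℚ) = qRatMap (x : OnePoint ℚ) := by
    intro x
    have := hT x
    rwa [matT_smul_coe, one_mul] at this
  have hTn : ∀ (c : ℤ) (x : ℚ), φ ((x + c : ℚ) : OnePoint ℚ) = qRatMap ((x + c : ℚ) : OnePoint ℚ) ↔
      φ (x : OnePoint ℚ) = qRatMap (x : OnePoint ℚ) := by
    intro c x
    induction c using Int.induction_on with
    | zero => simp
    | succ n ih =>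
      rw [← ih, ← hT1 (x + ((n : ℤ) : ℚ))]; push_cast; rw [← add_assoc]
    | pred n ih =>
      rw [← ih, ← hT1]; push_cast
      rw [show x + (-(n : ℚ) - 1) + 1 = x + -(n : ℚ) by ring]
  have h00 : φ ((0 : ℚ) : OnePoint ℚ) = qRatMap ((0 : ℚ) : OnePoint ℚ) := by rw [f0, g0]
  have hfin : ∀ (d : ℕ) (x : ℚ), x.den = d →
      φ (x : OnePoint ℚ) = qRatMap (x : OnePoint ℚ) := by
    intro d
    induction d using Nat.strong_induction_on with
    | _ d ih =>
    intro x hd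
    by_cases h1 : x.den = 1
    · have : x = 0 + (x.num : ℚ) := by rw [(Rat.den_eq_one_iff _).1 h1, zero_add]
      rw [this]
      exact (hTn _ _).2 h00
    · have hpos := ceil_sub_pos x h1
      set y : ℚ := 1 / ((⌈x⌉ : ℚ) - x) with hy
      have hy0 : y ≠ 0 := by rw [hy]; positivity
      have h := hS _ (ih _ (hd ▸ den_step_lt x h1) y rfl)
      rw [matS_smul_coe _ _ _ hy0, one_mul] at h
      have : x = -1 / y + (⌈x⌉ : ℚ) := by rw [hy]; field_simp; ring
      rw [this]
      exact (hTn _ _).2 h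
  funext x
  cases x with
  | infty =>
    have := hS _ h00
    rwa [matS_smul_zero] at this
  | coe x => exact hfin _ x rfl

/-- The formal Laurent series `Y` over `ℚ` is the `q`-analogue `[x]_q` of the real number `x`:
* if `x` is rational, `Y` is the expansion at `q = 0` of the rational function `[x]_q`;
* if `x` is irrational, then for every sequence of rationals `u n → x` the expansions at `q = 0`
  of `[u n]_q` stabilize to `Y`, coefficient by coefficient. -/
def IsQReal (x : ℝ) (Y : ℚ⸨X⸩) : Prop :=
  (∃ r : ℚ, (r : ℝ) = x ∧ Y = (qRat r : ℚ⸨X⸩)) ∨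
  (Irrational x ∧ ∀ u : ℕ → ℚ, Tendsto (fun n => (u n : ℝ)) atTop (𝓝 x) →
    ∀ k : ℤ, ∀ᶠ n in atTop, (qRat (u n) : ℚ⸨X⸩).coeff k = Y.coeff k)

/-- A power series with integer coefficients, seen as a Laurent series over `ℚ`. -/
noncomputable def toLaurent (F : ℤ⟦X⟧) : ℚ⸨X⸩ :=
  HahnSeries.ofPowerSeries ℤ ℚ (F.map (Int.castRingHom ℚ))

/-- The radius of convergence in `[0, ∞]` of `∑ Fₙ qⁿ`, as a power series in a complex variable. -/
noncomputable def radius (F : ℤ⟦X⟧) : ENNReal :=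
  (FormalMultilinearSeries.ofScalars ℂ (fun n => ((PowerSeries.coeff n F : ℤ) : ℂ))).radius

end QReal

/-! The subtractive Euclidean algorithm builds every positive rational from `1` by the moves `x ↦ x
+ 1` and `x ↦ x / (x + 1)`. On `q`-rationals they become `F ↦ q F + 1` and `F ↦ q F / (q F + 1)`.
Since `q F + 1` has constant term `1`, both preserve `ℤ⟦X⟧`, which gives integrality
(`exists_toLaurent_eq_qRat`).

Radius: in the weighted `ℓ¹` norm `∑ |Fₙ| rⁿ`, both moves preserve the ball of radius `1 / (1 - r)`
when `r < 1 / 2` and `r ^ 2 - 3 r + 1 ≥ 0`, that is, for `r ≤ (3 - √5) / 2`. So all positive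
rationals satisfy one bound (`wsum_qSeries_le`). Working with truncated norms avoids any prior
convergence question and lets the bound pass to coefficientwise limits.

Stabilization: both moves send series congruent modulo `q ^ n` to series congruent modulo `q ^ (n +
1)`. Undoing `n` moves near an irrational point, where the inverse moves are continuous, fixes the
first `n` coefficients (`exists_nhds_X_pow_dvd_sub`).

The choice `r = 1 / 3` then suffices, because `3 - 2 √2 < 1 / 3 < (3 - √5) / 2`. -/

namespace QReal

/-! ### Euclidean moves on rationals and on `q`-rationals -/

/-- Every positive rational is obtained from `1` by the maps `x ↦ x + 1` and `x ↦ x / (x + 1)`. -/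
theorem pos_rat_induction {P : ℚ → Prop} (one : P 1) (add : ∀ x, 0 < x → P x → P (x + 1))
    (div : ∀ x, 0 < x → P x → P (x / (x + 1))) (x : ℚ) (hx : 0 < x) : P x := by
  -- Subtractive Euclid: replace the larger of `a`, `b` by their difference. The fraction need not
  -- be reduced.
  have key : ∀ n a b : ℕ, 0 < a → 0 < b → a + b ≤ n → P ((a : ℚ) / b) := by
    intro n
    induction n with
    | zero => intro a b ha hb h; omega
    | succ n ih =>
      intro a b ha hb h
      have ha' : (0 : ℚ) < a := by exact_mod_cast ha
      have hb' : (0 : ℚ) < b := by exact_mod_cast hb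
      rcases lt_trichotomy a b with hab | hab | hab
      · obtain ⟨c, rfl⟩ := Nat.exists_eq_add_of_lt hab
        have hc : (0 : ℚ) < ((c + 1 : ℕ) : ℚ) := by exact_mod_cast Nat.succ_pos c
        have := div _ (div_pos ha' hc) (ih a (c + 1) ha (Nat.succ_pos c) (by omega))
        convert this using 1
        push_cast at hc hb' ⊢
        field_simp
        ring
      · subst hab
        rwa [div_self ha'.ne']
      · obtain ⟨c, rfl⟩ := Nat.exists_eq_add_of_lt hab
        have hc : (0 : ℚ) < ((c + 1 : ℕ) : ℚ) := by exact_mod_cast Nat.succ_pos c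
        have := add _ (div_pos hc hb') (ih (c + 1) b (Nat.succ_pos c) hb (by omega))
        convert this using 1
        push_cast
        field_simp
        ring
  have hnum : 0 < x.num := Rat.num_pos.2 hx
  have := key _ x.num.toNat x.den (by omega) x.den_pos le_rfl
  have e : ((x.num.toNat : ℕ) : ℚ) = (x.num : ℚ) := by
    rw [← Int.cast_natCast, Int.toNat_of_nonneg hnum.le]
  rwa [e, Rat.num_div_den] at this

/-- The move `x ↦ x / (x + 1)` is `S T⁻¹ S`, so the rules for `-1 / x` and `x + 1` determine its
quantization. The form without division carries over directly to `ℤ⟦X⟧`. -/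
theorem qRat_div_add_one (x : ℚ) (hx : 0 < x) :
    (RatFunc.X * qRat x + 1) * qRat (x / (x + 1)) = RatFunc.X * qRat x := by
  have hX := RatFunc.X_ne_zero (K := ℚ)
  obtain ⟨h1, h2⟩ := qRat_neg_inv x hx.ne'
  have hv : -1 / x - 1 ≠ 0 := by
    have : 0 < 1 / x := by positivity
    rw [neg_div]; linarith
  obtain ⟨h3, h4⟩ := qRat_neg_inv _ hv
  have e : -1 / (-1 / x - 1) = x / (x + 1) := by
    have : -1 / x - 1 = -((x + 1) / x) := by field_simp; ring
    rw [this, div_neg, neg_div, neg_neg, one_div_div]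
  have h5 := qRat_add_one (-1 / x - 1)
  rw [sub_add_cancel, h2] at h5
  rw [e] at h4
  rw [div_eq_iff (mul_ne_zero hX h1)] at h5
  rw [h4, mul_div_assoc', div_eq_iff (mul_ne_zero hX h3)]
  linear_combination h5

/-! ### Truncated weighted `ℓ¹` norms and the invariant ball -/

section WeightedSum

open PowerSeries

/-- Partial sums of the weighted `ℓ¹` norm of a power series. -/
noncomputable def wsum (r : ℝ) (F : ℤ⟦X⟧) (N : ℕ) : ℝ :=
  ∑ n ∈ Finset.range N, |((coeff n F : ℤ) : ℝ)| * r ^ n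

variable {r : ℝ}

theorem wsum_nonneg (hr : 0 ≤ r) (F : ℤ⟦X⟧) (N : ℕ) : 0 ≤ wsum r F N :=
  Finset.sum_nonneg fun _ _ => by positivity

theorem wsum_add_le (hr : 0 ≤ r) (F G : ℤ⟦X⟧) (N : ℕ) :
    wsum r (F + G) N ≤ wsum r F N + wsum r G N := by
  unfold wsum
  rw [← Finset.sum_add_distrib]
  refine Finset.sum_le_sum fun n _ => ?_
  rw [← add_mul, map_add, Int.cast_add]
  gcongr
  exact abs_add_le _ _

theorem wsum_neg (F : ℤ⟦X⟧) (N : ℕ) : wsum r (-F) N = wsum r F N := by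
  simp [wsum]

theorem wsum_monomial_le (hr : 0 ≤ r) (k N : ℕ) : wsum r (X ^ k) N ≤ r ^ k := by
  unfold wsum
  simp only [coeff_X_pow]
  calc _ = ∑ n ∈ Finset.range N, if n = k then r ^ k else 0 := by
        refine Finset.sum_congr rfl fun n _ => ?_
        split_ifs with h <;> simp [h]
    _ ≤ _ := by
        rw [Finset.sum_ite_eq']
        split_ifs
        · exact le_rfl
        · positivity

/-- Truncation keeps the norm submultiplicative: pairs of exponents with sum below `N` lie in the
square `[0, N)²`, and the remaining pairs contribute nonnegative terms. -/
theorem wsum_mul_le (hr : 0 ≤ r) (F G : ℤ⟦X⟧) (N : ℕ) :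
    wsum r (F * G) N ≤ wsum r F N * wsum r G N := by
  set f : ℕ × ℕ → ℝ := fun p =>
    (|((coeff p.1 F : ℤ) : ℝ)| * r ^ p.1) * (|((coeff p.2 G : ℤ) : ℝ)| * r ^ p.2) with hf
  have hf0 : ∀ p, 0 ≤ f p := fun p => by rw [hf]; positivity
  have h1 : wsum r (F * G) N ≤
      ∑ n ∈ Finset.range N, ∑ p ∈ Finset.HasAntidiagonal.antidiagonal n, f p := by
    refine Finset.sum_le_sum fun n _ => ?_
    rw [coeff_mul, Int.cast_sum]
    calc _ ≤ (∑ p ∈ Finset.HasAntidiagonal.antidiagonal n,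
          |((coeff p.1 F * coeff p.2 G : ℤ) : ℝ)|) * r ^ n := by
          gcongr
          exact Finset.abs_sum_le_sum_abs _ _
      _ = _ := by
          rw [Finset.sum_mul]
          refine Finset.sum_congr rfl fun p hp => ?_
          rw [← Finset.HasAntidiagonal.mem_antidiagonal.1 hp, Int.cast_mul, abs_mul, pow_add]
          simp only [hf]
          ring
  refine h1.trans ?_
  rw [wsum, wsum, Finset.sum_mul_sum, ← Finset.sum_product', ← Finset.sum_biUnion]
  · refine Finset.sum_le_sum_of_subset_of_nonneg ?_ fun p _ _ => hf0 p
    intro p hp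
    simp only [Finset.mem_biUnion, Finset.mem_range, Finset.HasAntidiagonal.mem_antidiagonal,
      Finset.mem_product] at hp ⊢
    obtain ⟨n, hn, hp⟩ := hp
    omega
  · intro m _ n _ hmn
    rw [Function.onFun, Finset.disjoint_left]
    intro p hp hq
    exact hmn ((Finset.HasAntidiagonal.mem_antidiagonal.1 hp).symm.trans (Finset.HasAntidiagonal.mem_antidiagonal.1 hq))

theorem wsum_X_mul_le (hr : 0 ≤ r) (F : ℤ⟦X⟧) (N : ℕ) :
    wsum r (X * F) N ≤ r * wsum r F N := by
  refine (wsum_mul_le hr X F N).trans ?_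
  have := wsum_monomial_le hr 1 N
  rw [pow_one, pow_one] at this
  exact mul_le_mul_of_nonneg_right this (wsum_nonneg hr F N)

/-- The disc of radius `1 / (1 - r)` is stable under `z ↦ q z + 1`. -/
theorem wsum_X_mul_add_one_le (hr : 0 ≤ r) (hr1 : r < 1) {F : ℤ⟦X⟧} {N : ℕ}
    (hF : wsum r F N ≤ 1 / (1 - r)) : wsum r (X * F + 1) N ≤ 1 / (1 - r) := by
  have h1 := wsum_monomial_le hr 0 N
  rw [pow_zero, pow_zero] at h1
  have h2 := wsum_add_le hr (X * F) 1 N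
  have h3 := wsum_X_mul_le hr F N
  have h4 := mul_le_mul_of_nonneg_left hF hr
  have h5 : 1 / (1 - r) = r * (1 / (1 - r)) + 1 := by
    have : 1 - r ≠ 0 := by linarith
    field_simp
    ring
  linarith

/-- The disc of radius `1 / (1 - r)` is stable under `z ↦ q z / (q z + 1)` as long as
`r ≤ (3 - √5) / 2`. -/
theorem wsum_mobius_le (hr : 0 ≤ r) (hr1 : r < 1 / 2) (hr2 : 0 ≤ r ^ 2 - 3 * r + 1)
    {F G : ℤ⟦X⟧} {N : ℕ} (hF : wsum r F N ≤ 1 / (1 - r)) (hG : (X * F + 1) * G = X * F) :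
    wsum r G N ≤ 1 / (1 - r) := by
  -- Solving for `G` this way replaces the inverse by a self-bound `w ≤ s + s w` with `s = r / (1 -
  -- r)`, and `r < 1 / 2` means `s < 1`.
  have e : G = X * F + -(X * F * G) := by linear_combination hG
  have h1 := wsum_add_le hr (X * F) (-(X * F * G)) N
  rw [← e, wsum_neg] at h1
  have h2 := wsum_mul_le hr (X * F) G N
  have h3 : wsum r (X * F) N ≤ r / (1 - r) := by
    have := (wsum_X_mul_le hr F N).trans (mul_le_mul_of_nonneg_left hF hr)
    rwa [mul_one_div] at this
  have hG0 := wsum_nonneg hr G N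
  have h4 : wsum r G N ≤ r / (1 - r) + r / (1 - r) * wsum r G N :=
    h1.trans (add_le_add h3 (h2.trans (mul_le_mul_of_nonneg_right h3 hG0)))
  have h1r : 0 < 1 - r := by linarith
  rw [le_div_iff₀ h1r]
  have h5 : wsum r G N * (1 - r) ≤ r + r * wsum r G N := by
    have := mul_le_mul_of_nonneg_right h4 h1r.le
    calc _ ≤ _ := this
      _ = _ := by field_simp
  have h6 : 0 < 1 - 2 * r := by linarith
  -- The self-bound gives `w (1 - 2 r) ≤ r`, and `r (1 - r) ≤ 1 - 2 r` is exactly `hr2`.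
  have h7 : (wsum r G N * (1 - r)) * (1 - 2 * r) ≤ 1 * (1 - 2 * r) := by
    nlinarith
  exact le_of_mul_le_mul_right h7 h6

theorem le_radius_of_wsum_le {r : NNReal} {F : ℤ⟦X⟧} {C : ℝ} (h : ∀ N, wsum r F N ≤ C) :
    (r : ENNReal) ≤ radius F := by
  refine FormalMultilinearSeries.le_radius_of_bound _ C fun n => ?_
  rw [FormalMultilinearSeries.ofScalars_norm, Complex.norm_intCast]
  refine le_trans ?_ (h (n + 1))
  exact Finset.single_le_sum (f := fun n => |((coeff n F : ℤ) : ℝ)| * (r : ℝ) ^ n)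
    (fun _ _ => by positivity) (Finset.self_mem_range_succ n)

end WeightedSum

/-! ### Integrality of the expansions of positive `q`-rationals -/

theorem toLaurent_injective : Function.Injective toLaurent :=
  HahnSeries.ofPowerSeries_injective.comp (PowerSeries.map_injective _ Int.cast_injective)

theorem toLaurent_X_mul_add_one (F : ℤ⟦X⟧) :
    toLaurent (PowerSeries.X * F + 1) =
      ((RatFunc.X : RatFunc ℚ) : ℚ⸨X⸩) * toLaurent F + 1 := by
  simp [toLaurent, RatFunc.coe_X]

theorem toLaurent_mul (F G : ℤ⟦X⟧) : toLaurent (F * G) = toLaurent F * toLaurent G := by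
  simp [toLaurent]

theorem toLaurent_coeff (F : ℤ⟦X⟧) (k : ℤ) :
    (toLaurent F).coeff k = if k < 0 then 0 else ((PowerSeries.coeff k.natAbs F : ℤ) : ℚ) := by
  rw [toLaurent, PowerSeries.coeff_coe]
  simp

theorem toLaurent_X_mul (F : ℤ⟦X⟧) :
    toLaurent (PowerSeries.X * F) = ((RatFunc.X : RatFunc ℚ) : ℚ⸨X⸩) * toLaurent F := by
  simp [toLaurent, RatFunc.coe_X]

/-- The denominator has constant term `1`, hence is invertible already over `ℤ`. -/
theorem exists_mobius (F : ℤ⟦X⟧) :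
    ∃ G, (PowerSeries.X * F + 1) * G = PowerSeries.X * F := by
  refine ⟨PowerSeries.invOfUnit (PowerSeries.X * F + 1) 1 * (PowerSeries.X * F), ?_⟩
  rw [← mul_assoc, PowerSeries.mul_invOfUnit _ _ (by simp), one_mul]

theorem coe_qRat_add_one {x : ℚ} {F : ℤ⟦X⟧} (hF : (qRat x : ℚ⸨X⸩) = toLaurent F) :
    (qRat (x + 1) : ℚ⸨X⸩) = toLaurent (PowerSeries.X * F + 1) := by
  rw [qRat_add_one, map_add, map_mul, map_one, hF, toLaurent_X_mul_add_one]

theorem coe_qRat_div_add_one {x : ℚ} (hx : 0 < x) {F G : ℤ⟦X⟧}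
    (hF : (qRat x : ℚ⸨X⸩) = toLaurent F)
    (hG : (PowerSeries.X * F + 1) * G = PowerSeries.X * F) :
    (qRat (x / (x + 1)) : ℚ⸨X⸩) = toLaurent G := by
  have h1 := congrArg (fun f : RatFunc ℚ => (f : ℚ⸨X⸩)) (qRat_div_add_one x hx)
  beta_reduce at h1
  have h2 := congrArg toLaurent hG
  rw [map_mul, map_add, map_mul, map_one, hF, ← toLaurent_X_mul_add_one] at h1
  rw [toLaurent_mul, toLaurent_X_mul] at h2
  refine mul_left_cancel₀ (fun h0 => ?_) (h1.trans h2.symm)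
  have := congrArg (fun Y : ℚ⸨X⸩ => Y.coeff 0) h0
  simp [toLaurent_coeff] at this

/-- For positive rational `x`, the Laurent series `[x]_q` is a power series with integer
coefficients. -/
theorem exists_toLaurent_eq_qRat (x : ℚ) (hx : 0 < x) :
    ∃ F, (qRat x : ℚ⸨X⸩) = toLaurent F := by
  refine pos_rat_induction (P := fun x => ∃ F, (qRat x : ℚ⸨X⸩) = toLaurent F) ?_ ?_ ?_ x hx
  · refine ⟨1, ?_⟩
    have : qRat 1 = 1 := by simpa [qInt_one] using qRat_intCast 1
    simp [this, toLaurent]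
  · exact fun x hx ih => ih.imp' _ fun F => coe_qRat_add_one
  · rintro x hx ⟨F, hF⟩
    exact (exists_mobius F).imp fun G => coe_qRat_div_add_one hx hF

open Classical in
/-- The power series `[x]_q` with integer coefficients, for positive rational `x`. -/
noncomputable def qSeries (x : ℚ) : ℤ⟦X⟧ :=
  if hx : 0 < x then (exists_toLaurent_eq_qRat x hx).choose else 0

theorem coe_qRat_eq {x : ℚ} (hx : 0 < x) : (qRat x : ℚ⸨X⸩) = toLaurent (qSeries x) := by
  rw [qSeries, dif_pos hx]
  exact (exists_toLaurent_eq_qRat x hx).choose_spec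

theorem qSeries_one : qSeries 1 = 1 := by
  apply toLaurent_injective
  have : qRat 1 = 1 := by simpa [qInt_one] using qRat_intCast 1
  rw [← coe_qRat_eq one_pos, this]
  simp [toLaurent]

theorem qSeries_add_one {x : ℚ} (hx : 0 < x) :
    qSeries (x + 1) = PowerSeries.X * qSeries x + 1 := by
  apply toLaurent_injective
  rw [← coe_qRat_eq (by positivity), coe_qRat_add_one (coe_qRat_eq hx)]

theorem qSeries_div_add_one {x : ℚ} (hx : 0 < x) :
    (PowerSeries.X * qSeries x + 1) * qSeries (x / (x + 1)) = PowerSeries.X * qSeries x := by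
  obtain ⟨G, hG⟩ := exists_mobius (qSeries x)
  have : qSeries (x / (x + 1)) = G := by
    apply toLaurent_injective
    rw [← coe_qRat_eq (by positivity), coe_qRat_div_add_one hx (coe_qRat_eq hx) hG]
  rw [this, hG]

theorem wsum_qSeries_le {r : ℝ} (hr : 0 ≤ r) (hr1 : r < 1 / 2) (hr2 : 0 ≤ r ^ 2 - 3 * r + 1)
    (N : ℕ) (x : ℚ) (hx : 0 < x) : wsum r (qSeries x) N ≤ 1 / (1 - r) := by
  refine pos_rat_induction (P := fun x => wsum r (qSeries x) N ≤ 1 / (1 - r)) ?_ ?_ ?_ x hx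
  · have := wsum_monomial_le hr 0 N
    rw [pow_zero, pow_zero] at this
    rw [qSeries_one]
    refine this.trans ?_
    rw [le_div_iff₀ (by linarith)]
    linarith
  · intro x hx ih
    rw [qSeries_add_one hx]
    exact wsum_X_mul_add_one_le hr (by linarith) ih
  · intro x hx ih
    exact wsum_mobius_le hr hr1 hr2 ih (qSeries_div_add_one hx)

/-! ### Stabilization near irrational numbers -/

/-- The difference `G - G'` equals `X (F - F')` divided by the two denominators, which are units;
the factor `X` is the gain of one degree. -/
theorem X_pow_dvd_mobius_sub {F F' G G' : ℤ⟦X⟧} {n : ℕ}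
    (hG : (PowerSeries.X * F + 1) * G = PowerSeries.X * F)
    (hG' : (PowerSeries.X * F' + 1) * G' = PowerSeries.X * F')
    (h : PowerSeries.X ^ n ∣ F - F') : PowerSeries.X ^ (n + 1) ∣ G - G' := by
  have hu : IsUnit ((PowerSeries.X * F + 1) * (PowerSeries.X * F' + 1)) := by
    rw [PowerSeries.isUnit_iff_constantCoeff]
    simp
  rw [← hu.dvd_mul_left]
  have : (PowerSeries.X * F + 1) * (PowerSeries.X * F' + 1) * (G - G') =
      PowerSeries.X * (F - F') := by
    linear_combination (PowerSeries.X * F' + 1) * hG - (PowerSeries.X * F + 1) * hG'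
  rw [this, pow_succ']
  exact mul_dvd_mul_left _ h

/-- Near an irrational number, the coefficients of `[x]_q` up to a given degree are constant. -/
theorem exists_nhds_X_pow_dvd_sub (n : ℕ) (x : ℝ) (hx : 0 < x) (hirr : Irrational x) :
    ∃ V ∈ 𝓝 x, ∀ y z : ℚ, (y : ℝ) ∈ V → (z : ℝ) ∈ V →
      PowerSeries.X ^ n ∣ qSeries y - qSeries z := by
  induction n generalizing x with
  | zero => exact ⟨Set.univ, univ_mem, fun y z _ _ => by simp⟩
  | succ n ih =>
    -- Undo the last move: `x / (1 - x)` if `x < 1`, `x - 1` if `x > 1`. Irrationality persists, so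
    -- the boundary value `1` never occurs.
    rcases lt_or_gt_of_ne hirr.ne_one with h | h
    · have h1 : 0 < 1 - x := by linarith
      have hirr' : Irrational (x / (1 - x)) := by
        intro ⟨s, hs⟩
        rw [eq_div_iff h1.ne'] at hs
        have hs1 : (0 : ℝ) < s + 1 := by
          have : (0 : ℝ) < s := by
            by_contra hneg
            nlinarith
          linarith
        refine hirr ⟨s / (s + 1), ?_⟩
        push_cast
        rw [div_eq_iff hs1.ne']
        linarith
      obtain ⟨V, hV, H⟩ := ih _ (div_pos hx h1) hirr'
      have hc : Tendsto (fun t : ℝ => t / (1 - t)) (𝓝 x) (𝓝 (x / (1 - x))) :=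
        tendsto_id.div (tendsto_const_nhds.sub tendsto_id) h1.ne'
      refine ⟨_, inter_mem (hc hV) (Ioo_mem_nhds hx h), ?_⟩
      have aux : ∀ y : ℚ, (y : ℝ) ∈ Set.Ioo (0 : ℝ) 1 →
          0 < y / (1 - y) ∧ y / (1 - y) / (y / (1 - y) + 1) = y := by
        intro y hy
        have hy0 : 0 < y := by exact_mod_cast hy.1
        have hy1 : y < 1 := by exact_mod_cast hy.2
        have hy2 : 0 < 1 - y := by linarith
        refine ⟨by positivity, ?_⟩
        field_simp
        ring
      intro y z hy hz
      obtain ⟨hy1, hy2⟩ := aux y hy.2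
      obtain ⟨hz1, hz2⟩ := aux z hz.2
      have hy3 := qSeries_div_add_one hy1
      have hz3 := qSeries_div_add_one hz1
      rw [hy2] at hy3
      rw [hz2] at hz3
      refine X_pow_dvd_mobius_sub hy3 hz3 (H _ _ ?_ ?_)
      · simpa using hy.1
      · simpa using hz.1
    · have hirr' : Irrational (x - 1) := by simpa using hirr.sub_natCast 1
      obtain ⟨V, hV, H⟩ := ih (x - 1) (by linarith) hirr'
      have hc : Tendsto (fun t : ℝ => t - 1) (𝓝 x) (𝓝 (x - 1)) :=
        tendsto_id.sub tendsto_const_nhds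
      refine ⟨_, inter_mem (hc hV) (Ioi_mem_nhds h), ?_⟩
      intro y z hy hz
      have hy1 : 0 < y - 1 := by
        have : (1 : ℚ) < y := by exact_mod_cast Set.mem_Ioi.1 hy.2
        linarith
      have hz1 : 0 < z - 1 := by
        have : (1 : ℚ) < z := by exact_mod_cast Set.mem_Ioi.1 hz.2
        linarith
      have hd := H (y - 1) (z - 1) (by simpa using hy.1) (by simpa using hz.1)
      have e : qSeries y - qSeries z =
          PowerSeries.X * (qSeries (y - 1) - qSeries (z - 1)) := by
        have h1 := qSeries_add_one hy1
        have h2 := qSeries_add_one hz1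
        rw [sub_add_cancel] at h1 h2
        rw [h1, h2]
        ring
      rw [e, pow_succ']
      exact mul_dvd_mul_left _ hd

/-- Near an irrational number, the series `[x]_q` stabilize coefficient by coefficient. -/
theorem exists_stable_series (x : ℝ) (hx : 0 < x) (hirr : Irrational x) :
    ∃ F : ℤ⟦X⟧, ∀ u : ℕ → ℚ, Tendsto (fun n => (u n : ℝ)) atTop (𝓝 x) →
      ∀ N, ∀ᶠ n in atTop, ∀ k < N,
        PowerSeries.coeff k (qSeries (u n)) = PowerSeries.coeff k F := by
  choose V hV H using fun n => exists_nhds_X_pow_dvd_sub n x hx hirr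
  obtain ⟨v, -, -, hv⟩ := Real.exists_seq_rat_strictMono_tendsto x
  choose m hm using fun n => (hv.eventually (hV n)).exists
  -- Coefficient `k` is read off at a rational in `V (k + 1)`, since congruence modulo `X ^ (k + 1)`
  -- is what controls degree `k`.
  refine ⟨PowerSeries.mk fun k => PowerSeries.coeff k (qSeries (v (m (k + 1)))), ?_⟩
  intro u hu N
  have : ∀ᶠ n in atTop, ∀ k ∈ Finset.range N, (u n : ℝ) ∈ V (k + 1) :=
    (Filter.eventually_all_finset _).2 fun k _ => hu.eventually (hV (k + 1))
  filter_upwards [this] with n hn k hk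
  have hd := H (k + 1) _ _ (hn k (Finset.mem_range.2 hk)) (hm (k + 1))
  rw [PowerSeries.coeff_mk]
  have := PowerSeries.X_pow_dvd_iff.1 hd k (Nat.lt_succ_self k)
  rwa [map_sub, sub_eq_zero] at this

/-! ### Well-definedness and the radius bound for real numbers -/

/-- For `x > 0` the series `[x]_q` is well defined, has integer coefficients, and has radius of
convergence at least `r` for every `r < (3 - √5) / 2`. -/
theorem exists_series_le_radius (x : ℝ) (hx : 0 < x) {r : NNReal} (hr1 : (r : ℝ) < 1 / 2)
    (hr2 : 0 ≤ (r : ℝ) ^ 2 - 3 * r + 1) :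
    ∃ F : ℤ⟦X⟧, (∀ Y : ℚ⸨X⸩, IsQReal x Y ↔ Y = toLaurent F) ∧ (r : ENNReal) ≤ radius F := by
  by_cases hirr : Irrational x
  · obtain ⟨F, hF⟩ := exists_stable_series x hx hirr
    obtain ⟨v, -, -, hv⟩ := Real.exists_seq_rat_strictMono_tendsto x
    have hpos : ∀ u : ℕ → ℚ, Tendsto (fun n => (u n : ℝ)) atTop (𝓝 x) →
        ∀ᶠ n in atTop, 0 < u n := fun u hu =>
      (hu.eventually (lt_mem_nhds hx)).mono fun n hn => by exact_mod_cast hn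
    have hstab : ∀ u : ℕ → ℚ, Tendsto (fun n => (u n : ℝ)) atTop (𝓝 x) →
        ∀ k : ℤ, ∀ᶠ n in atTop, (qRat (u n) : ℚ⸨X⸩).coeff k = (toLaurent F).coeff k := by
      intro u hu k
      filter_upwards [hF u hu (k.natAbs + 1), hpos u hu] with n hn hn0
      rw [coe_qRat_eq hn0, toLaurent_coeff, toLaurent_coeff, hn _ (Nat.lt_succ_self _)]
    refine ⟨F, fun Y => ⟨?_, ?_⟩, ?_⟩
    · rintro (⟨s, hs, -⟩ | ⟨-, hY⟩)
      · exact absurd ⟨s, hs⟩ hirr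
      · ext k
        obtain ⟨n, h1, h2⟩ := ((hY v hv k).and (hstab v hv k)).exists
        exact h1.symm.trans h2
    · rintro rfl
      exact Or.inr ⟨hirr, hstab⟩
    · refine le_radius_of_wsum_le (C := 1 / (1 - r)) fun N => ?_
      -- The truncated norm sees only the coefficients below `N`, so it equals that of a positive
      -- rational approximant.
      obtain ⟨n, hn, hn0⟩ := ((hF v hv N).and (hpos v hv)).exists
      refine le_of_eq_of_le ?_ (wsum_qSeries_le r.2 hr1 hr2 N (v n) hn0)
      refine Finset.sum_congr rfl fun k hk => ?_
      rw [hn k (Finset.mem_range.1 hk)]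
      rfl
  · obtain ⟨s, rfl⟩ := not_not.1 hirr
    have hs : 0 < s := by exact_mod_cast hx
    refine ⟨qSeries s, fun Y => ⟨?_, ?_⟩,
      le_radius_of_wsum_le fun N => wsum_qSeries_le r.2 hr1 hr2 N s hs⟩
    · rintro (⟨t, ht, hY⟩ | ⟨h, -⟩)
      · obtain rfl : t = s := by exact_mod_cast ht
        rw [hY, coe_qRat_eq hs]
      · exact absurd h hirr
    · intro hY
      exact Or.inl ⟨s, rfl, hY.trans (coe_qRat_eq hs).symm⟩

end QReal

theorem theorem6p4 (x : ℝ) (hx : 0 < x) :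
    ∃ F : ℤ⟦X⟧, (∀ Y : ℚ⸨X⸩, QReal.IsQReal x Y ↔ Y = QReal.toLaurent F) ∧
      ENNReal.ofReal (3 - 2 * Real.sqrt 2) < QReal.radius F := by
  obtain ⟨F, hF, hR⟩ := QReal.exists_series_le_radius x hx (r := 1 / 3)
    (by norm_num) (by norm_num)
  refine ⟨F, hF, lt_of_lt_of_le ?_ hR⟩
  have h1 : (4 / 3 : ℝ) < Real.sqrt 2 := Real.lt_sqrt_of_sq_lt (by norm_num)
  -- This gives `0 ≤ 3 - 2 √2`, needed to compare through `ENNReal.ofReal`.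
  have h2 : Real.sqrt 2 ≤ 3 / 2 := Real.sqrt_le_iff.2 (by norm_num)
  rw [ENNReal.ofReal_lt_coe_iff (by linarith)]
  push_cast
  linarith
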